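/- Let $R$ be an associative ring with identity, not necessarily commutative. Modules are unital. For a left $R$-module $M$ write $M^*=\operatorname{Hom}_R(M,R)$, a right $R$-module, and $\alpha^*=\operatorname{Hom}_R(\alpha,R)$ for a homomorphism $\alpha$. The following terms are used. * A (left or right) module $M$ is *FP-injective* if $\operatorname{Ext}^1_R(F,M)=0$ for every finitely presented module $F$ on the same side. It is *fp-injective* if for every monomorphism $\mu:K\to L$ of finitely presented modules on the same side the map $\operatorname{Hom}_R(L,M)\to\operatorname{Hom}_R(K,M)$ induced by $\mu$ is surjective. * A left module $M$ is *fp-flat* if for every monomorphism $\mu:K\to L$ of finitely presented right modules the map $\mu\otimes_R M:K\otimes_R M\to L\otimes_R M$ is injective. * A left module $K$ is an *FP-cogenerator* if for every non-zero homomorphism $f:M\to N$ from a finitely generated left module $M$ to a finitely presented left module $N$ there is $g\in\operatorname{Hom}_R(N,K)$ with $gf\neq 0$. It is a *cogenerator* if the same holds for all non-zero homomorphisms $f:M\to N$ of left modules. * A left module $M$ is *semireflexive* if the canonical homomorphism $M\to M^{**}$ is injective. **Theorem.** For a ring $R$ the following conditions are equivalent: 1. the right module $R_R$ is FP-injective;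 2. the left module ${}_RR$ is an FP-cogenerator; 3. there is an fp-flat left $R$-module that is an FP-cogenerator; 4. there is an fp-flat left $R$-module that is a cogenerator; 5. if $\alpha:M\to N$ is a homomorphism of finitely presented left $R$-modules such that $\alpha^*:N^*\to M^*$ is an epimorphism, then $\alpha$ is a monomorphism; 6. every finitely presented left $R$-module is semireflexive; 7. every finitely presented left $R$-module embeds in an fp-flat left $R$-module; 8. every left $R$-module embeds in an fp-flat left $R$-module; equivalently, every injective left $R$-module does (each of these two statements is equivalent to the other conditions); 9. every FP-injective left $R$-module is fp-flat; 10. every injective left $R$-module is fp-flat; 11. every indecomposable injective left $R$-module is fp-flat; 12. every flat right $R$-module is fp-injective. -/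

import Mathlib

universe u

namespace FPInj

open TensorProduct MulOpposite CategoryTheory

/-! Left `R`-modules are modules over `R`; right `R`-modules are modules over `Rᵐᵒᵖ`. A notion
stated for left modules over an arbitrary ring is applied to right modules by taking `Rᵐᵒᵖ` as
the ring. -/

section TensorProduct

variable (R : Type u) [Ring R]

/-- The subgroup of `K ⊗[ℤ] M` generated by the elements `k r ⊗ m - k ⊗ r m`, for a right
`R`-module `K` and a left `R`-module `M`. -/
def balancedRel (K M : Type u) [AddCommGroup K] [Module Rᵐᵒᵖ K] [AddCommGroup M] [Module R M] :
    AddSubgroup (K ⊗[ℤ] M) :=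
  AddSubgroup.closure
    {x | ∃ (k : K) (r : R) (m : M), x = (op r • k) ⊗ₜ[ℤ] m - k ⊗ₜ[ℤ] (r • m)}

/-- The tensor product `K ⊗_R M` of a right and a left module over a ring that need not be
commutative; it is an abelian group. -/
abbrev Tens (K M : Type u) [AddCommGroup K] [Module Rᵐᵒᵖ K] [AddCommGroup M] [Module R M] :
    Type u :=
  (K ⊗[ℤ] M) ⧸ balancedRel R K M

variable {R}
variable {K L M N : Type u} [AddCommGroup K] [Module Rᵐᵒᵖ K] [AddCommGroup L] [Module Rᵐᵒᵖ L]
  [AddCommGroup M] [Module R M] [AddCommGroup N] [Module R N]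

/-- The homomorphism `f ⊗ g : K ⊗[ℤ] M → L ⊗[ℤ] N` of abelian groups. -/
def mapInt (f : K →ₗ[Rᵐᵒᵖ] L) (g : M →ₗ[R] N) : K ⊗[ℤ] M →+ L ⊗[ℤ] N :=
  (TensorProduct.map f.toAddMonoidHom.toIntLinearMap
    g.toAddMonoidHom.toIntLinearMap).toAddMonoidHom

theorem balancedRel_le_comap (f : K →ₗ[Rᵐᵒᵖ] L) (g : M →ₗ[R] N) :
    balancedRel R K M ≤ (balancedRel R L N).comap (mapInt f g) := by
  rw [balancedRel, AddSubgroup.closure_le]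
  rintro _ ⟨k, r, m, rfl⟩
  refine AddSubgroup.subset_closure ⟨f k, r, g m, ?_⟩
  simp [mapInt]

/-- The homomorphism `f ⊗ g : K ⊗_R M → L ⊗_R N`, with `k ⊗ m ↦ f k ⊗ g m`. -/
def Tens.map (f : K →ₗ[Rᵐᵒᵖ] L) (g : M →ₗ[R] N) : Tens R K M →+ Tens R L N :=
  QuotientAddGroup.map _ _ (mapInt f g) (balancedRel_le_comap f g)

end TensorProduct

section LeftModules

variable (R : Type u) [Ring R] (M : Type u) [AddCommGroup M] [Module R M]

/-- `M` is FP-injective: `Ext¹_R(F, M) = 0` for every finitely presented module `F`. -/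
def IsFPInjective : Prop :=
  ∀ (F : Type u) [AddCommGroup F] [Module R F], Module.FinitePresentation R F →
    Subsingleton (Abelian.Ext (ModuleCat.of R F) (ModuleCat.of R M) 1)

/-- `M` is fp-injective: for every monomorphism `μ : K → L` of finitely presented modules the map
`Hom(μ, M) : Hom(L, M) → Hom(K, M)` is onto. -/
def IsFpInjective : Prop :=
  ∀ (K L : Type u) [AddCommGroup K] [Module R K] [AddCommGroup L] [Module R L],
    Module.FinitePresentation R K → Module.FinitePresentation R L →
    ∀ μ : K →ₗ[R] L, Function.Injective μ →
      Function.Surjective fun h : L →ₗ[R] M => h ∘ₗ μ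

/-- The left module `M` is fp-flat: `μ ⊗ M` is a monomorphism for every monomorphism
`μ : K → L` of finitely presented right modules. -/
def IsFpFlat : Prop :=
  ∀ (K L : Type u) [AddCommGroup K] [Module Rᵐᵒᵖ K] [AddCommGroup L] [Module Rᵐᵒᵖ L],
    Module.FinitePresentation Rᵐᵒᵖ K → Module.FinitePresentation Rᵐᵒᵖ L →
    ∀ μ : K →ₗ[Rᵐᵒᵖ] L, Function.Injective μ →
      Function.Injective (Tens.map μ (LinearMap.id : M →ₗ[R] M))

/-- `K` is an FP-cogenerator: for every non-zero homomorphism `f : M → N` from a finitely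
generated to a finitely presented module there is `g : N → K` with `g f ≠ 0`. -/
def IsFPCogenerator (K : Type u) [AddCommGroup K] [Module R K] : Prop :=
  ∀ (M N : Type u) [AddCommGroup M] [Module R M] [AddCommGroup N] [Module R N],
    Module.Finite R M → Module.FinitePresentation R N →
    ∀ f : M →ₗ[R] N, f ≠ 0 → ∃ g : N →ₗ[R] K, g ∘ₗ f ≠ 0

/-- `K` is a cogenerator of the category of all modules. -/
def IsCogenerator (K : Type u) [AddCommGroup K] [Module R K] : Prop :=
  IsCoseparator (ModuleCat.of R K)

/-- `M` embeds in an fp-flat module. -/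
def EmbedsInFpFlat : Prop :=
  ∃ (F : Type u) (_ : AddCommGroup F) (_ : Module R F),
    IsFpFlat R F ∧ ∃ i : M →ₗ[R] F, Function.Injective i

/-- `M` is indecomposable: it is non-zero and not the direct sum of two non-zero modules. -/
def IsIndecomposable : Prop :=
  Indecomposable (ModuleCat.of R M)

/-- The dual `M* = Hom_R(M, R)` of a left module; it is a right module through
`(φ r)(m) = φ(m) r`. -/
abbrev LDual : Type u := M →ₗ[R] R

/-- The canonical homomorphism `M → M**`, `m ↦ (φ ↦ φ m)`. -/
def evalMap : M →ₗ[R] (LDual R M →ₗ[Rᵐᵒᵖ] R) where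
  toFun m :=
    { toFun := fun φ => φ m
      map_add' := fun _ _ => rfl
      map_smul' := fun _ _ => rfl }
  map_add' m n := by ext φ; exact map_add φ m n
  map_smul' r m := by ext φ; exact map_smul φ r m

/-- `M` is semireflexive: the canonical homomorphism `M → M**` is a monomorphism. -/
def IsSemireflexive : Prop :=
  Function.Injective (evalMap R M)

variable {R M}

/-- The dual `α* : N* → M*`, `φ ↦ φ ∘ α`, of a homomorphism `α : M → N`. -/
def dualMap {N : Type u} [AddCommGroup N] [Module R N] (α : M →ₗ[R] N) :
    LDual R N →ₗ[Rᵐᵒᵖ] LDual R M :=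
  LinearMap.lcomp Rᵐᵒᵖ R α

end LeftModules

/-- A right `R`-module `F` is flat: `F ⊗_R -` preserves monomorphisms of left modules. -/
def IsFlatRight (R : Type u) [Ring R] (F : Type u) [AddCommGroup F] [Module Rᵐᵒᵖ F] : Prop :=
  ∀ (M N : Type u) [AddCommGroup M] [Module R M] [AddCommGroup N] [Module R N]
    (g : M →ₗ[R] N), Function.Injective g →
      Function.Injective (Tens.map (LinearMap.id : F →ₗ[Rᵐᵒᵖ] F) g)

end FPInj

/-! Everything turns on semireflexivity of finitely presented left modules, that is, on which
elements are killed by all functionals. Let `M` be given by generators `k i` and a relation matrix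
`a`, and let `x = ∑ c i • k i`. Functionals on `M` are the solutions `y` of `a y = 0`, so `x` is
killed by all of them exactly when `c y = 0` for every such `y`. This is what makes `R` embed in the
pushout `L` of `a` and the row `c`, a finitely presented right module
(`exists_finitePresentation_pushout`). Tensoring `R → L` with an fp-flat `E` shows that `x` dies
under every map `M → E` (`IsFpFlat.map_eq_zero`), so enough maps to fp-flat modules force
semireflexivity. A retraction `L → R` gives it as well, by making `c` a combination of the rows of
`a`. Conversely, semireflexivity of cokernels of matrices solves the linear systems that extend maps
from finitely generated right ideals and submodules of `Rᵐ` to `R`. Once `R_R` is FP-injective, `K ⊗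
M` embeds in `Hom(K*, M)` for FP-injective `M` and finitely presented `K`, and `L* → K*` is onto, so
`M` is fp-flat. For flat `F`, maps `K → F` factor through some `Rˡ` and extend coordinatewise. -/

open FPInj TensorProduct MulOpposite CategoryTheory Abelian

namespace FPInj

/-! ### Generators and relations -/

section Presentations

variable {S : Type u} [Ring S]

theorem map_eq_sum_smul_single {T : Type*} [AddCommGroup T] [Module S T] {n : ℕ}
    (h : (Fin n → S) →ₗ[S] T) (c : Fin n → S) : h c = ∑ i, c i • h (Pi.single i 1) := by
  conv_lhs => rw [← Finset.univ_sum_single c, map_sum]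
  refine Finset.sum_congr rfl fun i _ => ?_
  rw [← map_smul, ← Pi.single_smul, smul_eq_mul, mul_one]

/-- A finitely presented module has finitely many generators `k i` with finitely many relations
`∑ i, a j i • k i = 0` through which homomorphisms out of it are defined. -/
theorem exists_presentation (M : Type u) [AddCommGroup M] [Module S M]
    (hM : Module.FinitePresentation S M) :
    ∃ (n m : ℕ) (k : Fin n → M) (a : Fin m → Fin n → S),
      (∀ x : M, ∃ c : Fin n → S, x = ∑ i, c i • k i) ∧
      (∀ j, ∑ i, a j i • k i = 0) ∧
      ∀ (T : Type u) [AddCommGroup T] [Module S T] (t : Fin n → T),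
        (∀ j, ∑ i, a j i • t i = 0) → ∃ φ : M →ₗ[S] T, ∀ i, φ (k i) = t i := by
  obtain ⟨n, m, f, g, hf, hfg⟩ := Module.FinitePresentation.exists_fin' S M
  refine ⟨n, m, fun i => f (Pi.single i 1), fun j => g (Pi.single j 1), fun x => ?_, fun j => ?_,
    fun T _ _ t ht => ?_⟩
  · obtain ⟨c, rfl⟩ := hf x
    exact ⟨c, map_eq_sum_smul_single f c⟩
  · rw [← map_eq_sum_smul_single f]
    exact (hfg _).2 ⟨_, rfl⟩
  · have hker : LinearMap.ker f ≤ LinearMap.ker (Fintype.linearCombination S t) := by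
      intro c hc
      obtain ⟨d, rfl⟩ := (hfg c).1 hc
      have : Fintype.linearCombination S t ∘ₗ g = 0 := by
        ext j
        simpa [Fintype.linearCombination_apply] using ht j
      exact LinearMap.congr_fun this d
    refine ⟨(LinearMap.ker f).liftQ _ hker ∘ₗ (f.quotKerEquivOfSurjective hf).symm.toLinearMap,
      fun i => ?_⟩
    have : (f.quotKerEquivOfSurjective hf).symm (f (Pi.single i 1)) =
        Submodule.Quotient.mk (Pi.single i 1) := by
      rw [LinearEquiv.symm_apply_eq]; rfl
    simp [this, Fintype.linearCombination_apply_single]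

theorem finitePresentation_quotient {L : Type u} [AddCommGroup L] [Module S L]
    (hL : Module.FinitePresentation S L) (K : Submodule S L) (hK : K.FG) :
    Module.FinitePresentation S (L ⧸ K) :=
  Module.finitePresentation_of_surjective K.mkQ K.mkQ_surjective (by rwa [Submodule.ker_mkQ])

theorem fg_span_range {L : Type u} [AddCommGroup L] [Module S L] {n : ℕ} (v : Fin n → L) :
    (Submodule.span S (Set.range v)).FG :=
  Submodule.fg_span (Set.finite_range v)

theorem mem_span_range_iff {L : Type u} [AddCommGroup L] [Module S L] {n : ℕ} (v : Fin n → L)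
    (x : L) : x ∈ Submodule.span S (Set.range v) ↔ ∃ c : Fin n → S, ∑ i, c i • v i = x :=
  Submodule.mem_span_range_iff_exists_fun S

end Presentations

/-! ### FP-injectivity as an extension property -/

section FPInjective

variable {S : Type u} [Ring S]

/-- By projectivity of the free module in a presentation of `F`, every class in `Ext¹` comes from a
map on the finitely generated kernel; it vanishes when that map extends. -/
theorem IsFPInjective.of_extends (X : Type u) [AddCommGroup X] [Module S X]
    (h : ∀ (n : ℕ) (K : Submodule S (Fin n → S)), K.FG → ∀ φ : K →ₗ[S] X,
      ∃ ψ : (Fin n → S) →ₗ[S] X, ∀ x : K, ψ x = φ x) : IsFPInjective S X := by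
  intro F _ _ hF
  obtain ⟨n, m, f, g, hf, hfg⟩ := Module.FinitePresentation.exists_fin' S F
  have hK : (LinearMap.ker f).FG := by
    rw [LinearMap.exact_iff.1 hfg, LinearMap.range_eq_map]
    exact Module.Finite.fg_top.map g
  let T : ShortComplex (ModuleCat.{u} S) :=
    ModuleCat.shortComplexOfCompEqZero (LinearMap.ker f).subtype f (by ext; simp)
  have hT : T.ShortExact := ModuleCat.shortComplex_shortExact T
    (LinearMap.exact_subtype_ker_map f) (Submodule.injective_subtype _) hf
  have : Projective T.X₂ := by
    have : Module.Projective S (Fin n → S) := inferInstance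
    exact (IsProjective.iff_projective (R := S) (Fin n → S)).1 this
  refine subsingleton_of_forall_eq 0 fun e => ?_
  obtain ⟨x₁, hx₁⟩ := Ext.contravariant_sequence_exact₃ hT (ModuleCat.of S X) e
    (Ext.eq_zero_of_projective (n := 0) _) (n₀ := 0) rfl
  obtain ⟨φ, rfl⟩ := (Ext.mk₀_bijective _ _).2 x₁
  obtain ⟨ψ, hψ⟩ := h n _ hK φ.hom
  have hφ : φ = T.f ≫ ModuleCat.ofHom ψ := by
    ext x
    exact (hψ x).symm
  rw [← hx₁, hφ, ← Ext.mk₀_comp_mk₀, ← Ext.comp_assoc, hT.extClass_comp, Ext.zero_comp]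
  all_goals rfl

/-- The cokernel of `μ` is finitely presented, since `K` need only be finitely generated for this;
hence the obstruction in `Ext¹` vanishes. -/
theorem IsFPInjective.exists_extension {X : Type u} [AddCommGroup X] [Module S X]
    (hX : IsFPInjective S X) {K L : Type u} [AddCommGroup K] [Module S K] [AddCommGroup L]
    [Module S L] (hK : Module.Finite S K) (hL : Module.FinitePresentation S L) (μ : K →ₗ[S] L)
    (hμ : Function.Injective μ) (φ : K →ₗ[S] X) : ∃ ψ : L →ₗ[S] X, ∀ x, ψ (μ x) = φ x := by
  have hF : Module.FinitePresentation S (L ⧸ LinearMap.range μ) :=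
    finitePresentation_quotient hL _ (by
      rw [LinearMap.range_eq_map]; exact Module.Finite.fg_top.map μ)
  let T : ShortComplex (ModuleCat.{u} S) :=
    ModuleCat.shortComplexOfCompEqZero μ (LinearMap.range μ).mkQ
      μ.exact_map_mkQ_range.linearMap_comp_eq_zero
  have hT : T.ShortExact := ModuleCat.shortComplex_shortExact T
    μ.exact_map_mkQ_range hμ (Submodule.mkQ_surjective _)
  have := hX (L ⧸ LinearMap.range μ) hF
  obtain ⟨x₂, hx₂⟩ := Ext.contravariant_sequence_exact₁ hT (ModuleCat.of S X)
    (Ext.mk₀ (ModuleCat.ofHom φ)) (n₁ := 1) rfl (this.elim _ _)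
  obtain ⟨ψ, rfl⟩ := (Ext.mk₀_bijective _ _).2 x₂
  rw [Ext.mk₀_comp_mk₀] at hx₂
  have := (Ext.mk₀_bijective _ _).1 hx₂
  exact ⟨ψ.hom, fun x => LinearMap.congr_fun (congrArg ModuleCat.Hom.hom this) x⟩

theorem isFPInjective_of_injective {X : Type u} [AddCommGroup X] [Module S X]
    (hX : Module.Injective S X) : IsFPInjective S X :=
  IsFPInjective.of_extends X fun _ K _ φ => hX.out K.subtype K.injective_subtype φ

end FPInjective

/-! ### Calculus of the tensor product -/

section Tens

variable {R : Type u} [Ring R] {K L M N : Type u} [AddCommGroup K] [Module Rᵐᵒᵖ K]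
  [AddCommGroup L] [Module Rᵐᵒᵖ L] [AddCommGroup M] [Module R M] [AddCommGroup N] [Module R N]

/-- The class of `k ⊗ m` in `K ⊗_R M`. -/
def Tens.tmul (k : K) (m : M) : Tens R K M := QuotientAddGroup.mk (k ⊗ₜ[ℤ] m)

theorem Tens.add_tmul (k l : K) (m : M) :
    (Tens.tmul (k + l) m : Tens R K M) = Tens.tmul k m + Tens.tmul l m := by
  rw [Tens.tmul, TensorProduct.add_tmul]; rfl

theorem Tens.tmul_add (k : K) (m n : M) :
    (Tens.tmul k (m + n) : Tens R K M) = Tens.tmul k m + Tens.tmul k n := by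
  rw [Tens.tmul, TensorProduct.tmul_add]; rfl

theorem Tens.smul_tmul (k : K) (r : R) (m : M) :
    (Tens.tmul (op r • k) m : Tens R K M) = Tens.tmul k (r • m) := by
  refine (QuotientAddGroup.eq_iff_sub_mem).2 (AddSubgroup.subset_closure ⟨k, r, m, rfl⟩)

theorem Tens.sum_tmul {ι : Type*} (s : Finset ι) (k : ι → K) (m : M) :
    (Tens.tmul (∑ i ∈ s, k i) m : Tens R K M) = ∑ i ∈ s, Tens.tmul (k i) m :=
  map_sum (AddMonoidHom.mk' (fun k => (Tens.tmul k m : Tens R K M))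
    fun a b => Tens.add_tmul a b m) k s

theorem Tens.tmul_sum {ι : Type*} (s : Finset ι) (k : K) (m : ι → M) :
    (Tens.tmul k (∑ i ∈ s, m i) : Tens R K M) = ∑ i ∈ s, Tens.tmul k (m i) :=
  map_sum (AddMonoidHom.mk' (fun m => (Tens.tmul k m : Tens R K M))
    fun a b => Tens.tmul_add k a b) m s

theorem Tens.zero_tmul (m : M) : (Tens.tmul (0 : K) m : Tens R K M) = 0 := by
  rw [Tens.tmul, TensorProduct.zero_tmul]; rfl

theorem Tens.tmul_zero (k : K) : (Tens.tmul k (0 : M) : Tens R K M) = 0 := by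
  rw [Tens.tmul, TensorProduct.tmul_zero]; rfl

theorem Tens.neg_tmul (k : K) (m : M) :
    (Tens.tmul (-k) m : Tens R K M) = -Tens.tmul k m :=
  map_neg (AddMonoidHom.mk' (fun k => (Tens.tmul k m : Tens R K M))
    fun a b => Tens.add_tmul a b m) k

@[simp]
theorem Tens.map_tmul (f : K →ₗ[Rᵐᵒᵖ] L) (g : M →ₗ[R] N) (k : K) (m : M) :
    Tens.map f g (Tens.tmul k m) = Tens.tmul (f k) (g m) := rfl

@[elab_as_elim]
theorem Tens.induction {P : Tens R K M → Prop} (t : Tens R K M) (h0 : P 0)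
    (h1 : ∀ k m, P (Tens.tmul k m)) (h2 : ∀ s t, P s → P t → P (s + t)) : P t := by
  obtain ⟨x, rfl⟩ := QuotientAddGroup.mk_surjective t
  induction x using TensorProduct.induction_on with
  | zero => exact h0
  | tmul k m => exact h1 k m
  | add x y hx hy => exact h2 _ _ hx hy

/-- A balanced biadditive map induces a homomorphism on the tensor product. -/
def Tens.lift {A : Type*} [AddCommGroup A] (f : K →+ M →+ A)
    (hf : ∀ k (r : R) m, f (op r • k) m = f k (r • m)) : Tens R K M →+ A :=
  QuotientAddGroup.lift _ (TensorProduct.liftAddHom f fun z k m => by simp) <| by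
    rw [balancedRel, AddSubgroup.closure_le]
    rintro _ ⟨k, r, m, rfl⟩
    simp [hf]

/-- The homomorphism `K ⊗_R M → M`, `k ⊗ m ↦ ψ k • m`, for `ψ ∈ K*`. -/
def Tens.contract (M : Type u) [AddCommGroup M] [Module R M] (ψ : K →ₗ[Rᵐᵒᵖ] R) :
    Tens R K M →+ M :=
  Tens.lift (AddMonoidHom.mk' (fun k => AddMonoidHom.mk' (fun m => ψ k • m) (smul_add _))
    fun a b => by ext m; simp [add_smul]) fun k r m => by simp [mul_smul]

@[simp]
theorem Tens.contract_tmul (ψ : K →ₗ[Rᵐᵒᵖ] R) (k : K) (m : M) :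
    Tens.contract M ψ (Tens.tmul k m) = ψ k • m := rfl

theorem Tens.exists_eq_sum {n : ℕ} (k : Fin n → K)
    (hk : ∀ x : K, ∃ c : Fin n → Rᵐᵒᵖ, x = ∑ i, c i • k i) (t : Tens R K M) :
    ∃ m : Fin n → M, t = ∑ i, Tens.tmul (k i) (m i) := by
  induction t using Tens.induction with
  | h0 => exact ⟨0, by simp [Tens.tmul_zero]⟩
  | h1 x m =>
    obtain ⟨c, rfl⟩ := hk x
    refine ⟨fun i => unop (c i) • m, ?_⟩
    rw [Tens.sum_tmul]
    exact Finset.sum_congr rfl fun i _ => Tens.smul_tmul (k i) (unop (c i)) m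
  | h2 s t hs ht =>
    obtain ⟨m, rfl⟩ := hs
    obtain ⟨m', rfl⟩ := ht
    exact ⟨m + m', by simp [Tens.tmul_add, Finset.sum_add_distrib]⟩

theorem Tens.exists_eq_tmul_one (t : Tens R K R) : ∃ x : K, t = Tens.tmul x 1 := by
  induction t using Tens.induction with
  | h0 => exact ⟨0, (Tens.zero_tmul _).symm⟩
  | h1 k r => exact ⟨op r • k, by rw [Tens.smul_tmul, smul_eq_mul, mul_one]⟩
  | h2 s t hs ht =>
    obtain ⟨x, rfl⟩ := hs
    obtain ⟨y, rfl⟩ := ht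
    exact ⟨x + y, (Tens.add_tmul _ _ _).symm⟩

theorem Tens.exists_eq_one_tmul (t : Tens R R M) : ∃ x : M, t = Tens.tmul 1 x := by
  induction t using Tens.induction with
  | h0 => exact ⟨0, (Tens.tmul_zero _).symm⟩
  | h1 r m => exact ⟨r • m, by rw [← Tens.smul_tmul, op_smul_eq_mul, one_mul]⟩
  | h2 s t hs ht =>
    obtain ⟨x, rfl⟩ := hs
    obtain ⟨y, rfl⟩ := ht
    exact ⟨x + y, (Tens.tmul_add _ _ _).symm⟩

theorem Tens.tmul_one_injective : Function.Injective fun x : K => (Tens.tmul x 1 : Tens R K R) := by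
  let f : Tens R K R →+ K :=
    Tens.lift (AddMonoidHom.mk' (fun k => AddMonoidHom.mk' (fun r : R => op r • k)
      fun a b => by simp [add_smul]) fun a b => by ext r; simp)
      fun k r m => by simp [mul_smul]
  exact Function.LeftInverse.injective (g := f) fun x => one_smul _ x

theorem Tens.one_tmul_injective : Function.Injective fun x : M => (Tens.tmul 1 x : Tens R R M) :=
  Function.LeftInverse.injective (g := Tens.contract M LinearMap.id) fun x => one_smul _ x

theorem isFpFlat_self : IsFpFlat R R := by
  intro K L _ _ _ _ _ _ μ hμ s t hst
  obtain ⟨x, rfl⟩ := Tens.exists_eq_tmul_one s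
  obtain ⟨y, rfl⟩ := Tens.exists_eq_tmul_one t
  exact congrArg (Tens.tmul · 1) (hμ (Tens.tmul_one_injective hst))

theorem isFlatRight_self : IsFlatRight R R := by
  intro M N _ _ _ _ g hg s t hst
  obtain ⟨x, rfl⟩ := Tens.exists_eq_one_tmul s
  obtain ⟨y, rfl⟩ := Tens.exists_eq_one_tmul t
  exact congrArg (Tens.tmul 1) (hg (Tens.one_tmul_injective hst))

end Tens

/-! ### Functionals, semireflexivity and the pushout -/

variable {R : Type u} [Ring R]

theorem finitePresentation_right_self : Module.FinitePresentation Rᵐᵒᵖ R := by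
  let e : Rᵐᵒᵖ ≃ₗ[Rᵐᵒᵖ] R :=
    { (opAddEquiv (α := R)).symm with map_smul' := fun _ _ => rfl }
  exact Module.FinitePresentation.of_equiv e

/-- The pushout of `Rⁿ → Rᵐ` and a row `x : Rⁿ → R` of right modules is finitely presented, and `R`
embeds in it if `x` vanishes on the kernel of `Rⁿ → Rᵐ`. -/
theorem exists_finitePresentation_pushout {n m : ℕ} (a : Fin m → Fin n → R) (x : Fin n → R)
    (h : ∀ y : Fin n → R, (∀ j, ∑ i, a j i * y i = 0) → ∑ i, x i * y i = 0) :
    ∃ (L : Type u) (_ : AddCommGroup L) (_ : Module Rᵐᵒᵖ L) (ι : R →ₗ[Rᵐᵒᵖ] L) (ε : Fin m → L),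
      Module.FinitePresentation Rᵐᵒᵖ L ∧ Function.Injective ι ∧
      ∀ i, ι (x i) + ∑ j, op (a j i) • ε j = 0 := by
  classical
  have hR := finitePresentation_right_self (R := R)
  let v : Fin n → (Fin m → R) × R := fun i => (fun j => a j i, x i)
  let P := Submodule.span Rᵐᵒᵖ (Set.range v)
  refine ⟨((Fin m → R) × R) ⧸ P, inferInstance, inferInstance,
    P.mkQ ∘ₗ LinearMap.inr Rᵐᵒᵖ (Fin m → R) R, fun j => P.mkQ (Pi.single j 1, 0),
    finitePresentation_quotient inferInstance _ (fg_span_range v), ?_, fun i => ?_⟩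
  · rw [injective_iff_map_eq_zero]
    intro r hr
    have hr' : ((0, r) : (Fin m → R) × R) ∈ P := by simpa using hr
    -- The coefficients `c` of a relation `(0, r) = ∑ v i c i` satisfy `a c = 0` in the first
    -- coordinate, and then `r = x c = 0` in the second.
    obtain ⟨c, hc⟩ := (mem_span_range_iff v _).1 hr'
    have h1 := congrArg Prod.fst hc
    have h2 := congrArg Prod.snd hc
    rw [Prod.fst_sum] at h1
    rw [Prod.snd_sum] at h2
    rw [← show _ = r from h2]
    refine h (fun i => unop (c i)) fun j => ?_
    have := congrFun h1 j
    rwa [Finset.sum_apply] at this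
  · have : ((0, x i) : (Fin m → R) × R) + ∑ j, op (a j i) • (Pi.single j 1, 0) = v i := by
      refine Prod.ext (funext fun j => ?_) ?_
      · simp [Prod.fst_sum, Finset.sum_apply, Pi.single_apply, v]
      · simp [Prod.snd_sum, v]
    have hv : P.mkQ (v i) = 0 :=
      (Submodule.Quotient.mk_eq_zero P).2 (Submodule.subset_span ⟨i, rfl⟩)
    rw [← this] at hv
    simp only [map_add, map_sum, map_smul] at hv
    exact hv

theorem linearMap_sum_smul {S M N : Type*} [Ring S] [AddCommGroup M] [Module S M]
    [AddCommGroup N] [Module S N] (φ : M →ₗ[S] N) {n : ℕ} (c : Fin n → S) (k : Fin n → M) :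
    φ (∑ i, c i • k i) = ∑ i, c i • φ (k i) := by
  simp

/-- A homomorphism from a finitely presented module to an fp-flat module kills the elements that
all homomorphisms to `R` kill. -/
theorem IsFpFlat.map_eq_zero {E : Type u} [AddCommGroup E] [Module R E] (hE : IsFpFlat R E)
    {M : Type u} [AddCommGroup M] [Module R M] (hM : Module.FinitePresentation R M) (x : M)
    (hx : ∀ φ : M →ₗ[R] R, φ x = 0) (g : M →ₗ[R] E) : g x = 0 := by
  obtain ⟨n, m, k, a, hk, ha, hlift⟩ := exists_presentation M hM
  obtain ⟨c, rfl⟩ := hk x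
  obtain ⟨L, _, _, ι, ε, hL, hι, hε⟩ := exists_finitePresentation_pushout a c fun y hy => by
    obtain ⟨φ, hφ⟩ := hlift R y hy
    simpa [hφ] using hx φ
  -- It suffices that `ι 1 ⊗ g x = 0` in `L ⊗ E`. Moving the `c i` to the left and using `ι (c i) =
  -- -∑ ε j a j i` leaves the terms `ε j ⊗ g (∑ a j i k i)`, which vanish.
  refine Tens.one_tmul_injective
    (hE R L finitePresentation_right_self hL ι hι ?_ : _ = (Tens.tmul 1 0 : Tens R R E))
  have hε' : ∀ i, ι (c i) = -∑ j, op (a j i) • ε j := fun i => eq_neg_of_add_eq_zero_left (hε i)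
  beta_reduce
  rw [linearMap_sum_smul, Tens.tmul_sum]
  simp only [← Tens.smul_tmul, map_sum, Tens.map_tmul, op_smul_eq_mul, one_mul, hε', Tens.neg_tmul,
    Tens.sum_tmul, LinearMap.id_coe, id_eq, map_zero, Tens.tmul_zero]
  rw [Finset.sum_neg_distrib, Finset.sum_comm, neg_eq_zero]
  refine Finset.sum_eq_zero fun j _ => ?_
  simp only [Tens.smul_tmul]
  rw [← Tens.tmul_sum]
  have := congrArg g (ha j)
  rw [linearMap_sum_smul, map_zero] at this
  rw [this, Tens.tmul_zero]

theorem isSemireflexive_iff {M : Type u} [AddCommGroup M] [Module R M] :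
    IsSemireflexive R M ↔ ∀ x : M, (∀ φ : M →ₗ[R] R, φ x = 0) → x = 0 := by
  rw [IsSemireflexive, injective_iff_map_eq_zero]
  refine forall_congr' fun x => imp_congr_left ?_
  exact ⟨fun h φ => LinearMap.congr_fun h φ, fun h => LinearMap.ext h⟩

theorem EmbedsInFpFlat.isSemireflexive {M : Type u} [AddCommGroup M] [Module R M]
    (hM : Module.FinitePresentation R M) (h : EmbedsInFpFlat R M) : IsSemireflexive R M := by
  obtain ⟨F, _, _, hF, i, hi⟩ := h
  exact isSemireflexive_iff.2 fun x hx => hi (by rw [hF.map_eq_zero hM x hx, map_zero])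

/-- The cogenerator property is tested on `R → M`, `1 ↦ x`. -/
theorem IsFPCogenerator.isSemireflexive {E : Type u} [AddCommGroup E] [Module R E]
    (hE : IsFpFlat R E) (hE' : IsFPCogenerator R E) {M : Type u} [AddCommGroup M] [Module R M]
    (hM : Module.FinitePresentation R M) : IsSemireflexive R M := by
  refine isSemireflexive_iff.2 fun x hx => ?_
  by_contra h0
  obtain ⟨g, hg⟩ := hE' R M inferInstance hM (LinearMap.toSpanSingleton R M x) fun h =>
    h0 (by simpa using LinearMap.congr_fun h 1)
  exact hg (LinearMap.ext_ring (by simp [hE.map_eq_zero hM x hx]))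

theorem IsSemireflexive.isFPCogenerator
    (h : ∀ (M : Type u) [AddCommGroup M] [Module R M],
      Module.FinitePresentation R M → IsSemireflexive R M) : IsFPCogenerator R R := by
  intro M N _ _ _ _ _ hN f hf
  by_contra! hg
  refine hf (LinearMap.ext fun x => ?_)
  exact isSemireflexive_iff.1 (h N hN) _ fun φ => LinearMap.congr_fun (hg φ) x

theorem IsCogenerator.isFPCogenerator {K : Type u} [AddCommGroup K] [Module R K]
    (h : IsCogenerator R K) : IsFPCogenerator R K := by
  intro M N _ _ _ _ _ _ f hf
  by_contra! hg
  refine hf (congrArg ModuleCat.Hom.hom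
    ((isCoseparator_def _).1 h (ModuleCat.ofHom f) 0 fun g => ?_))
  rw [Limits.zero_comp]
  exact ModuleCat.hom_ext (hg g.hom)

/-- If `M` is semireflexive and `α* : N* → M*` is an epimorphism, then `α : M → N` is a
monomorphism. -/
theorem IsSemireflexive.injective_of_dualMap {M N : Type u} [AddCommGroup M] [Module R M]
    [AddCommGroup N] [Module R N] (hM : IsSemireflexive R M) (α : M →ₗ[R] N)
    (hα : Function.Surjective (dualMap α)) : Function.Injective α := by
  rw [injective_iff_map_eq_zero]
  refine fun x hx => isSemireflexive_iff.1 hM x fun φ => ?_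
  obtain ⟨ψ, rfl⟩ := hα φ
  exact (congrArg ψ hx).trans (map_zero ψ)

/-- If all functionals kill `x`, they factor through `M → M ⧸ R x`, whose dual is therefore onto; so
this projection is injective and `x = 0`. -/
theorem isSemireflexive_of_injective_of_dualMap
    (h : ∀ (M N : Type u) [AddCommGroup M] [Module R M] [AddCommGroup N] [Module R N],
        Module.FinitePresentation R M → Module.FinitePresentation R N →
        ∀ α : M →ₗ[R] N, Function.Surjective (dualMap α) → Function.Injective α)
    {M : Type u} [AddCommGroup M] [Module R M] (hM : Module.FinitePresentation R M) :
    IsSemireflexive R M := by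
  refine isSemireflexive_iff.2 fun x hx => ?_
  let P := Submodule.span R {x}
  refine h M (M ⧸ P) hM (finitePresentation_quotient hM P (Submodule.fg_span_singleton x)) P.mkQ
    (fun φ => ?_) ?_
  · exact ⟨P.liftQ φ (by simpa [P, Submodule.span_le] using hx φ), LinearMap.ext fun y => rfl⟩
  · rw [map_zero]
    exact (Submodule.Quotient.mk_eq_zero P).2 (Submodule.mem_span_singleton_self x)

/-- Extending `φ` from the span of the columns `A i` to `Rᵐ` means writing the row `x i = φ (A i)`
as a left combination of the rows of the matrix. A functional on `Rⁿ` modulo the rows is a `y` with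
`∑ A i y i = 0`; applying `φ` shows that it kills `x`, so by semireflexivity `x` lies in the row
span. -/
theorem isFPInjective_of_isSemireflexive
    (h : ∀ (M : Type u) [AddCommGroup M] [Module R M],
      Module.FinitePresentation R M → IsSemireflexive R M) : IsFPInjective Rᵐᵒᵖ R := by
  refine IsFPInjective.of_extends R fun m K hK φ => ?_
  obtain ⟨n, A, hA⟩ := (Submodule.fg_iff_exists_fin_generating_family).1 hK
  have hAK : ∀ i, A i ∈ K := fun i => hA ▸ Submodule.subset_span ⟨i, rfl⟩
  let row : Fin m → Fin n → R := fun j i => unop (A i j)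
  let x : Fin n → R := fun i => φ ⟨A i, hAK i⟩
  let P := Submodule.span R (Set.range row)
  have hx : P.mkQ x = 0 := by
    refine isSemireflexive_iff.1 (h _ (finitePresentation_quotient inferInstance P
      (fg_span_range row))) _ fun ψ => ?_
    let y : Fin n → R := fun i => ψ (P.mkQ (Pi.single i 1))
    have hy : ∀ c : Fin n → R, ψ (P.mkQ c) = ∑ i, c i * y i :=
      fun c => map_eq_sum_smul_single (ψ ∘ₗ P.mkQ) c
    have hrow : ∀ j, ∑ i, row j i * y i = 0 := fun j => by
      rw [← hy, show P.mkQ (row j) = 0 from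
        (Submodule.Quotient.mk_eq_zero P).2 (Submodule.subset_span ⟨j, rfl⟩), map_zero]
    have hsum : ∑ i, op (y i) • (⟨A i, hAK i⟩ : K) = 0 := by
      refine Subtype.ext (funext fun j => unop_injective ?_)
      simpa [Finset.sum_apply] using hrow j
    have := congrArg φ hsum
    rw [linearMap_sum_smul φ (fun i => op (y i)) fun i => ⟨A i, hAK i⟩, map_zero] at this
    rw [hy]
    exact this
  obtain ⟨z, hz⟩ := (mem_span_range_iff row x).1 ((Submodule.Quotient.mk_eq_zero P).1 hx)
  let Φ : (Fin m → Rᵐᵒᵖ) →ₗ[Rᵐᵒᵖ] R := Fintype.linearCombination Rᵐᵒᵖ z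
  refine ⟨Φ, fun ⟨v, hv⟩ => ?_⟩
  rw [← hA] at hv
  obtain ⟨c, rfl⟩ := (mem_span_range_iff A v).1 hv
  have hv' : (⟨∑ i, c i • A i, hA ▸ hv⟩ : K) = ∑ i, c i • ⟨A i, hAK i⟩ :=
    Subtype.ext (by simp)
  rw [linearMap_sum_smul]
  refine Eq.trans ?_ (Eq.trans (linearMap_sum_smul φ c fun i => ⟨A i, hAK i⟩).symm
    (congrArg φ hv'.symm))
  refine Finset.sum_congr rfl fun i _ => congrArg (c i • ·) ?_
  rw [show φ ⟨A i, hAK i⟩ = x i from rfl, ← hz, Finset.sum_apply]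
  rfl

/-- The identity of `R` extends along `R → L` to a retraction `ρ`, and the `-ρ (ε j)` express `c`
through the relations of `M`. -/
theorem isSemireflexive_of_isFpInjective (h : IsFpInjective Rᵐᵒᵖ R) {M : Type u}
    [AddCommGroup M] [Module R M] (hM : Module.FinitePresentation R M) : IsSemireflexive R M := by
  refine isSemireflexive_iff.2 fun x hx => ?_
  obtain ⟨n, m, k, a, hk, ha, hlift⟩ := exists_presentation M hM
  obtain ⟨c, rfl⟩ := hk x
  obtain ⟨L, _, _, ι, ε, hL, hι, hε⟩ := exists_finitePresentation_pushout a c fun y hy => by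
    obtain ⟨φ, hφ⟩ := hlift R y hy
    simpa [hφ] using hx φ
  obtain ⟨ρ, hρ⟩ := h R L finitePresentation_right_self hL ι hι LinearMap.id
  have hc : ∀ i, c i = -∑ j, ρ (ε j) * a j i := by
    intro i
    have h1 := congrArg ρ (hε i)
    rw [map_add, linearMap_sum_smul, map_zero,
      show ρ (ι (c i)) = c i from LinearMap.congr_fun hρ (c i)] at h1
    exact eq_neg_of_add_eq_zero_left h1
  simp only [hc, neg_smul, Finset.sum_smul, mul_smul]
  rw [Finset.sum_neg_distrib, Finset.sum_comm, neg_eq_zero]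
  exact Finset.sum_eq_zero fun j _ => by rw [← Finset.smul_sum, ha, smul_zero]

/-! ### FP-injective left modules over a right FP-injective ring -/

/-- If `M` is FP-injective and `K` finitely presented, then `K ⊗ M → Hom(K*, M)` is injective. -/
theorem IsFPInjective.eq_zero_of_contract {M : Type u} [AddCommGroup M] [Module R M]
    (hM : IsFPInjective R M) {K : Type u} [AddCommGroup K] [Module Rᵐᵒᵖ K]
    (hK : Module.FinitePresentation Rᵐᵒᵖ K) (t : Tens R K M)
    (ht : ∀ φ : K →ₗ[Rᵐᵒᵖ] R, Tens.contract M φ t = 0) : t = 0 := by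
  obtain ⟨n, m, k, a, hk, ha, hlift⟩ := exists_presentation K hK
  obtain ⟨v, rfl⟩ := Tens.exists_eq_sum k hk t
  let A : (Fin n → R) →ₗ[R] (Fin m → R) := LinearMap.pi fun j =>
    Fintype.linearCombination R fun i => unop (a j i)
  let w : (Fin n → R) →ₗ[R] M := Fintype.linearCombination R v
  -- The kernel of `A` is `K*`, and evaluating `w` at `φ ∈ K*` gives the contraction of the tensor
  -- with `φ`.
  have hker : LinearMap.ker A ≤ LinearMap.ker w := by
    intro p hp
    obtain ⟨φ, hφ⟩ := hlift R p fun j => congrFun hp j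
    have := ht φ
    simp only [map_sum, Tens.contract_tmul, hφ] at this
    exact this
  let φ : LinearMap.range A →ₗ[R] M :=
    (LinearMap.ker A).liftQ w hker ∘ₗ A.quotKerEquivRange.symm.toLinearMap
  have hφ : ∀ p, φ ⟨A p, p, rfl⟩ = w p := by
    intro p
    have : A.quotKerEquivRange.symm ⟨A p, p, rfl⟩ = Submodule.Quotient.mk p := by
      rw [LinearEquiv.symm_apply_eq]; rfl
    simp [φ, this]
  obtain ⟨ψ, hψ⟩ := hM.exists_extension inferInstance inferInstance (LinearMap.range A).subtype
    (Submodule.injective_subtype _) φ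
  have hv : ∀ i, v i = ∑ j, unop (a j i) • ψ (Pi.single j 1) := by
    intro i
    have h1 : w (Pi.single i 1) = v i := by simp [w, Fintype.linearCombination_apply_single]
    rw [← h1, ← hφ, ← hψ, Submodule.subtype_apply, map_eq_sum_smul_single]
    simp [A, Fintype.linearCombination_apply_single]
  simp only [hv, Tens.tmul_sum, ← Tens.smul_tmul, op_unop]
  rw [Finset.sum_comm]
  exact Finset.sum_eq_zero fun j _ => by rw [← Tens.sum_tmul, ha, Tens.zero_tmul]

theorem isFpFlat_of_isFPInjective (h : IsFPInjective Rᵐᵒᵖ R) {M : Type u} [AddCommGroup M]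
    [Module R M] (hM : IsFPInjective R M) : IsFpFlat R M := by
  intro K L _ _ _ _ hK hL μ hμ
  rw [injective_iff_map_eq_zero]
  refine fun t ht => hM.eq_zero_of_contract hK t fun φ => ?_
  obtain ⟨ψ, hψ⟩ := h.exists_extension inferInstance hL μ hμ φ
  have : Tens.contract M φ t = Tens.contract M ψ (Tens.map μ LinearMap.id t) := by
    clear ht
    induction t using Tens.induction with
    | h0 => simp
    | h1 k m => simp [hψ]
    | h2 s t hs ht => simp [hs, ht]
  rw [this, ht, map_zero]

/-! ### Flat right modules -/

/-- The equational criterion: a finite relation `∑ f i a j i = 0` in a flat right module is a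
consequence of relations in the ring. -/
theorem IsFlatRight.exists_factorization {F : Type u} [AddCommGroup F] [Module Rᵐᵒᵖ F]
    (hF : IsFlatRight R F) {n m : ℕ} (f : Fin n → F) (a : Fin m → Fin n → Rᵐᵒᵖ)
    (h : ∀ j, ∑ i, a j i • f i = 0) :
    ∃ (l : ℕ) (g : Fin l → F) (b : Fin l → Fin n → R),
      (∀ p j, ∑ i, b p i * unop (a j i) = 0) ∧ ∀ i, f i = ∑ p, op (b p i) • g p := by
  let A : (Fin n → R) →ₗ[R] (Fin m → R) := LinearMap.pi fun j =>
    Fintype.linearCombination R fun i => unop (a j i)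
  let N := LinearMap.ker A
  -- `T` is the image of `F ⊗ N` in `F ⊗ Rⁿ = Fⁿ`. Flatness applied to `Rⁿ ⧸ N → Rᵐ` kills `∑ f i ⊗
  -- e i` in `F ⊗ (Rⁿ ⧸ N)`, and `σ` turns this into `f ∈ T`.
  let T : AddSubgroup (Fin n → F) :=
    AddSubgroup.closure {x | ∃ (g : F) (b : Fin n → R), b ∈ N ∧ x = fun i => op (b i) • g}
  let τ : F →+ (Fin n → R) →+ (Fin n → F) :=
    AddMonoidHom.mk' (fun g => AddMonoidHom.mk' (fun b i => op (b i) • g)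
      fun b c => by ext i; simp [add_smul]) fun g g' => by ext b i; simp
  let σ : Tens R F ((Fin n → R) ⧸ N) →+ (Fin n → F) ⧸ T :=
    Tens.lift (AddMonoidHom.mk' (fun g =>
      QuotientAddGroup.lift N.toAddSubgroup ((QuotientAddGroup.mk' T).comp (τ g)) fun b hb =>
        (QuotientAddGroup.eq_zero_iff _).2 (AddSubgroup.subset_closure ⟨g, b, hb, rfl⟩))
      fun g g' => by
        refine AddMonoidHom.ext fun x => ?_
        obtain ⟨b, rfl⟩ := N.mkQ_surjective x
        exact congrArg (QuotientAddGroup.mk' T)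
          (congrArg (fun z => z b) (τ.map_add g g')))
      fun g r x => by
        obtain ⟨b, rfl⟩ := N.mkQ_surjective x
        refine congrArg (QuotientAddGroup.mk' T) (funext fun i => ?_)
        exact (mul_smul (op (b i)) (op r) g).symm
  have hσ : ∀ (g : F) (b : Fin n → R),
      σ (Tens.tmul g (N.mkQ b)) = QuotientAddGroup.mk' T fun i => op (b i) • g := fun _ _ => rfl
  let ι : ((Fin n → R) ⧸ N) →ₗ[R] (Fin m → R) := N.liftQ A le_rfl
  have hι : Function.Injective ι := LinearMap.ker_eq_bot.1 (Submodule.ker_liftQ_eq_bot' _ _ rfl)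
  have ht : (∑ i, Tens.tmul (f i) (N.mkQ (Pi.single i 1)) : Tens R F _) = 0 := by
    refine hF _ _ ι hι ?_
    have hA : ∀ i, ι (N.mkQ (Pi.single i 1)) = ∑ j, unop (a j i) • Pi.single j 1 := by
      intro i
      refine funext fun j => ?_
      simp [ι, A, Fintype.linearCombination_apply_single, Finset.sum_apply, Pi.single_apply]
    simp only [map_sum, Tens.map_tmul, hA, Tens.tmul_sum, ← Tens.smul_tmul, op_unop,
      LinearMap.id_coe, id_eq, map_zero]
    rw [Finset.sum_comm]
    exact Finset.sum_eq_zero fun j _ => by rw [← Tens.sum_tmul, h, Tens.zero_tmul]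
  have hf : f ∈ T := by
    rw [← QuotientAddGroup.eq_zero_iff, ← map_zero σ, ← ht, map_sum]
    simp only [hσ]
    rw [← map_sum]
    refine congrArg (QuotientAddGroup.mk' T) (funext fun i => ?_)
    simp [Finset.sum_apply, Pi.single_apply, apply_ite op, ite_smul]
  have hT : ∀ x ∈ T, ∃ (l : ℕ) (g : Fin l → F) (b : Fin l → Fin n → R),
      (∀ p, b p ∈ N) ∧ ∀ i, x i = ∑ p, op (b p i) • g p := by
    intro x hx
    induction hx using AddSubgroup.closure_induction with
    | mem x hx =>
      obtain ⟨g, b, hb, rfl⟩ := hx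
      exact ⟨1, fun _ => g, fun _ => b, fun _ => hb, fun i => by simp⟩
    | zero => exact ⟨0, Fin.elim0, Fin.elim0, fun p => p.elim0, fun i => by simp⟩
    | add x y _ _ hx hy =>
      obtain ⟨l, g, b, hb, hx⟩ := hx
      obtain ⟨l', g', b', hb', hy⟩ := hy
      refine ⟨l + l', Fin.append g g', Fin.append b b', fun p => ?_, fun i => ?_⟩
      · refine Fin.addCases (fun p => ?_) (fun p => ?_) p <;> simp [hb, hb']
      · simp [Fin.sum_univ_add, hx, hy]
    | neg x _ hx =>
      obtain ⟨l, g, b, hb, hx⟩ := hx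
      exact ⟨l, -g, b, hb, fun i => by simp [hx]⟩
  obtain ⟨l, g, b, hb, hfg⟩ := hT f hf
  exact ⟨l, g, b, fun p j => congrFun (hb p) j, hfg⟩

theorem IsFlatRight.isFpInjective (h : IsFPInjective Rᵐᵒᵖ R) {F : Type u} [AddCommGroup F]
    [Module Rᵐᵒᵖ F] (hF : IsFlatRight R F) : IsFpInjective Rᵐᵒᵖ F := by
  intro K L _ _ _ _ hK hL μ hμ φ
  obtain ⟨n, m, k, a, hk, ha, hlift⟩ := exists_presentation K hK
  obtain ⟨l, g, b, hb, hf⟩ := hF.exists_factorization (fun i => φ (k i)) a fun j => by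
    rw [← linearMap_sum_smul, ha, map_zero]
  choose β hβ using fun p => hlift R (b p) fun j => hb p j
  choose γ hγ using fun p => h.exists_extension inferInstance hL μ hμ (β p)
  let Φ : L →ₗ[Rᵐᵒᵖ] F :=
    ∑ p, LinearMap.toSpanSingleton Rᵐᵒᵖ F (g p) ∘ₗ
      ({ opAddEquiv (α := R) with map_smul' := fun _ _ => rfl } : R ≃ₗ[Rᵐᵒᵖ] Rᵐᵒᵖ).toLinearMap ∘ₗ
      γ p
  have hΦ : ∀ x, Φ x = ∑ p, op (γ p x) • g p := by
    intro x
    simp [Φ]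
  refine ⟨Φ, LinearMap.ext fun x => ?_⟩
  obtain ⟨c, rfl⟩ := hk x
  rw [LinearMap.comp_apply, linearMap_sum_smul μ, linearMap_sum_smul Φ, linearMap_sum_smul φ]
  refine Finset.sum_congr rfl fun i _ => congrArg (c i • ·) ?_
  rw [hΦ, hf]
  exact Finset.sum_congr rfl fun p _ => by rw [hγ, hβ]

/-! ### Injective cogenerators and indecomposable injectives -/

theorem exists_injective_embedding (M : Type u) [AddCommGroup M] [Module R M] :
    ∃ (Q : Type u) (_ : AddCommGroup Q) (_ : Module R Q),
      Module.Injective R Q ∧ ∃ i : M →ₗ[R] Q, Function.Injective i := by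
  obtain ⟨⟨Q, hQ, i, hi⟩⟩ := EnoughInjectives.presentation (ModuleCat.of R M)
  exact ⟨Q, inferInstance, inferInstance, Module.injective_module_of_injective_object R Q, i.hom,
    (ModuleCat.mono_iff_injective i).1 hi⟩

theorem exists_isFpFlat_isCogenerator
    (h : ∀ (M : Type u) [AddCommGroup M] [Module R M], Module.Injective R M → IsFpFlat R M) :
    ∃ (K : Type u) (_ : AddCommGroup K) (_ : Module R K), IsFpFlat R K ∧ IsCogenerator R K := by
  classical
  -- An injective module containing every cyclic module `R ⧸ I` is a cogenerator: the embedding of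
  -- `R y` extends to all of `Y`.
  obtain ⟨Q, _, _, hQ, i, hi⟩ :=
    exists_injective_embedding (R := R) (∀ I : Ideal R, R ⧸ I)
  refine ⟨Q, _, _, h Q hQ, (isCoseparator_def _).2 fun X Y f g hfg => ?_⟩
  ext x
  by_contra hne
  rw [← sub_eq_zero] at hne
  set y := f.hom x - g.hom x with hy
  let s := LinearMap.toSpanSingleton R Y y
  let I : Ideal R := LinearMap.ker s
  let j : (R ⧸ I) →ₗ[R] Q := i ∘ₗ LinearMap.single R (fun I : Ideal R => R ⧸ I) I
  obtain ⟨θ, hθ⟩ := hQ.out (I.liftQ s le_rfl)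
    (LinearMap.ker_eq_bot.1 (Submodule.ker_liftQ_eq_bot' _ _ rfl)) j
  have h0 : θ y = 0 := by
    have := congrArg (fun z => z.hom x) (hfg (ModuleCat.ofHom θ))
    rw [hy, map_sub, sub_eq_zero]
    exact this
  have h1 := hθ (I.mkQ 1)
  rw [show I.liftQ s le_rfl (I.mkQ 1) = y by simp [s], h0] at h1
  have h2 : I.mkQ 1 = 0 := Pi.single_injective (M := fun I : Ideal R => R ⧸ I) I (by
    refine hi ?_
    rw [Pi.single_zero, map_zero]
    exact h1.symm)
  exact hne (by simpa [I, s] using (Submodule.Quotient.mk_eq_zero I).1 h2)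

/-- A non-zero `x` avoids a submodule `N` such that every larger submodule contains `x`. -/
theorem exists_notMem_forall_mem_sup {M : Type u} [AddCommGroup M] [Module R M] {x : M}
    (hx : x ≠ 0) :
    ∃ N : Submodule R M, x ∉ N ∧ ∀ y ∉ N, ∃ r : R, x - r • y ∈ N := by
  obtain ⟨N, -, hN⟩ := zorn_le_nonempty₀ {N : Submodule R M | x ∉ N} (fun c hc hchain C hCc =>
    ⟨sSup c, fun hx' => by
      obtain ⟨D, hD, hxD⟩ := (Submodule.mem_sSup_of_directed ⟨C, hCc⟩ hchain.directedOn).1 hx'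
      exact hc hD hxD, fun D hD => le_sSup hD⟩) ⊥ (by simpa using hx)
  refine ⟨N, hN.prop, fun y hy => ?_⟩
  have hxy : x ∈ N ⊔ Submodule.span R {y} := by
    by_contra h
    exact hy (hN.le_of_ge (y := N ⊔ Submodule.span R {y}) h le_sup_left
      (Submodule.mem_sup_right (Submodule.mem_span_singleton_self y)))
  obtain ⟨c, hc, d, hd, rfl⟩ := Submodule.mem_sup.1 hxy
  obtain ⟨r, rfl⟩ := Submodule.mem_span_singleton.1 hd
  exact ⟨r, by rwa [add_sub_cancel_right]⟩

/-- A submodule of an injective module that is maximal among the essential extensions of `R x`, for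
`R x` simple, is a direct summand. -/
theorem exists_retraction_of_maximal {Q : Type u} [AddCommGroup Q] [Module R Q]
    (hQ : Module.Injective R Q) {x : Q} {E : Submodule R Q}
    (hE : Maximal (fun E : Submodule R Q =>
      x ∈ E ∧ ∀ y ∈ E, y ≠ 0 → x ∈ Submodule.span R {y}) E) (hx : x ≠ 0) :
    ∃ r : Q →ₗ[R] E, ∀ y : E, r y = y := by
  -- `C` meets `E` trivially, because each non-zero element of `E` has `x` as a multiple. The
  -- inclusion of `E` extends to `Q ⧸ C → Q`, and maximality of `E` keeps the image inside `E`.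
  obtain ⟨C, hxC, hC⟩ := exists_notMem_forall_mem_sup (R := R) hx
  let p : E →ₗ[R] Q ⧸ C := C.mkQ ∘ₗ E.subtype
  have hp : Function.Injective p := by
    rw [injective_iff_map_eq_zero]
    intro y hy
    by_contra hy0
    have hyC : (y : Q) ∈ C := (Submodule.Quotient.mk_eq_zero C).1 hy
    exact hxC ((Submodule.span_singleton_le_iff_mem _ _).2 hyC
      (hE.prop.2 y y.2 fun h => hy0 (Subtype.ext h)))
  obtain ⟨h, hh⟩ := hQ.out p hp E.subtype
  have hhx : h (C.mkQ x) = x := hh ⟨x, hE.prop.1⟩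
  -- `h` is injective since `Q ⧸ C` is an essential extension of the image of `R x`
  have hrange : ∀ z : Q ⧸ C, z ≠ 0 → x ∈ Submodule.span R {h z} := by
    intro z hz
    obtain ⟨y, rfl⟩ := C.mkQ_surjective z
    have hy : y ∉ C := fun hy => hz ((Submodule.Quotient.mk_eq_zero C).2 hy)
    obtain ⟨r, hr⟩ := hC y hy
    refine Submodule.mem_span_singleton.2 ⟨r, ?_⟩
    have hr0 : C.mkQ (x - r • y) = 0 := (Submodule.Quotient.mk_eq_zero C).2 hr
    rw [map_sub, sub_eq_zero] at hr0
    rw [← map_smul, ← map_smul, ← hr0, hhx]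
  have hle : LinearMap.range h ≤ E := by
    refine hE.le_of_ge ⟨⟨_, hhx⟩, ?_⟩ fun y hy => ⟨_, hh ⟨y, hy⟩⟩
    rintro _ ⟨z, rfl⟩ hz
    exact hrange z fun h0 => hz (by rw [h0, map_zero])
  exact ⟨(h ∘ₗ C.mkQ).codRestrict E fun y => hle ⟨_, rfl⟩, fun y => Subtype.ext (hh y)⟩

theorem injective_of_retraction {Q : Type u} [AddCommGroup Q] [Module R Q]
    (hQ : Module.Injective R Q) {E : Submodule R Q} (r : Q →ₗ[R] E) (hr : ∀ y : E, r y = y) :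
    Module.Injective R E where
  out X Y _ _ _ _ f hf g := by
    obtain ⟨h, hh⟩ := hQ.out f hf (E.subtype ∘ₗ g)
    exact ⟨r ∘ₗ h, fun x => by
      rw [LinearMap.comp_apply, hh]
      exact hr (g x)⟩

/-- In a product, `x` would be a multiple of both `(y, 0)` and `(0, z)`, so both its coordinates
would vanish. -/
theorem isIndecomposable_of_mem_span {E : Type u} [AddCommGroup E] [Module R E] {x : E}
    (hx : x ≠ 0) (h : ∀ y : E, y ≠ 0 → x ∈ Submodule.span R {y}) : IsIndecomposable R E := by
  refine ⟨fun h0 => hx (@Subsingleton.elim _ (ModuleCat.subsingleton_of_isZero h0) _ _),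
    fun Y Z e => ?_⟩
  let e' : E ≃ₗ[R] Y × Z := (e ≪≫ ModuleCat.biprodIsoProd Y Z).toLinearEquiv
  by_contra! hYZ
  have key : ∀ W : ModuleCat.{u} R, ¬ Limits.IsZero W → ∃ w : W, w ≠ 0 := by
    intro W hW
    by_contra! hw
    have : Subsingleton W := subsingleton_of_forall_eq 0 hw
    exact hW (ModuleCat.isZero_of_subsingleton W)
  obtain ⟨y, hy⟩ := key Y hYZ.1
  obtain ⟨z, hz⟩ := key Z hYZ.2
  have hxe : ∀ w : Y × Z, w ≠ 0 → ∃ r : R, r • w = e' x := by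
    intro w hw
    obtain ⟨r, hr⟩ := Submodule.mem_span_singleton.1
      (h (e'.symm w) fun h0 => hw (by simpa using h0))
    exact ⟨r, by rw [← hr, map_smul, e'.apply_symm_apply]⟩
  obtain ⟨r, hr⟩ := hxe (y, 0) fun h0 => hy (congrArg Prod.fst h0)
  obtain ⟨s, hs⟩ := hxe (0, z) fun h0 => hz (congrArg Prod.snd h0)
  refine hx (e'.map_eq_zero_iff.1 (Prod.ext ?_ ?_))
  · rw [← hs]; simp
  · rw [← hr]; simp

/-- Homomorphisms to indecomposable injective modules separate the elements of a module. -/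
theorem exists_map_ne_zero_of_indecomposable_injective {M : Type u} [AddCommGroup M] [Module R M]
    {x : M} (hx : x ≠ 0) :
    ∃ (E : Type u) (_ : AddCommGroup E) (_ : Module R E), IsIndecomposable R E ∧
      Module.Injective R E ∧ ∃ g : M →ₗ[R] E, g x ≠ 0 := by
  obtain ⟨N, hxN, hN⟩ := exists_notMem_forall_mem_sup (R := R) hx
  obtain ⟨Q, _, _, hQ, i, hi⟩ := exists_injective_embedding (R := R) (M ⧸ N)
  let x' : Q := i (N.mkQ x)
  have hx' : x' ≠ 0 := fun h0 =>
    hxN ((Submodule.Quotient.mk_eq_zero N).1 (hi (h0.trans (map_zero i).symm)))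
  -- Zorn's lemma starts from the copy of `M ⧸ N`: by the choice of `N`, each of its non-zero
  -- elements has `x'` as a multiple.
  obtain ⟨E, hiE, hE⟩ := zorn_le_nonempty₀
    {E : Submodule R Q | x' ∈ E ∧ ∀ y ∈ E, y ≠ 0 → x' ∈ Submodule.span R {y}}
    (fun c hc hchain C hCc => ⟨sSup c, ⟨le_sSup hCc (hc hCc).1, fun y hy => by
      obtain ⟨D, hD, hyD⟩ := (Submodule.mem_sSup_of_directed ⟨C, hCc⟩ hchain.directedOn).1 hy
      exact (hc hD).2 y hyD⟩, fun D hD => le_sSup hD⟩) (LinearMap.range i) ⟨⟨_, rfl⟩, by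
      rintro _ ⟨z, rfl⟩ hz
      obtain ⟨y, rfl⟩ := N.mkQ_surjective z
      have hy : y ∉ N := fun hy => hz (by
        rw [show N.mkQ y = 0 from (Submodule.Quotient.mk_eq_zero N).2 hy, map_zero])
      obtain ⟨r, hr⟩ := hN y hy
      refine Submodule.mem_span_singleton.2 ⟨r, ?_⟩
      have hr0 : N.mkQ (x - r • y) = 0 := (Submodule.Quotient.mk_eq_zero N).2 hr
      rw [map_sub, sub_eq_zero] at hr0
      rw [← map_smul, ← map_smul, ← hr0]⟩
  obtain ⟨r, hr⟩ := exists_retraction_of_maximal hQ hE hx'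
  refine ⟨E, inferInstance, inferInstance, isIndecomposable_of_mem_span
    (x := (⟨x', hE.prop.1⟩ : E)) (fun h0 => hx' (congrArg Subtype.val h0)) fun y hy => ?_,
    injective_of_retraction hQ r hr, r ∘ₗ i ∘ₗ N.mkQ, fun h0 => hx' ?_⟩
  · obtain ⟨s, hs⟩ := Submodule.mem_span_singleton.1
      (hE.prop.2 y y.2 fun h0 => hy (Subtype.ext h0))
    exact Submodule.mem_span_singleton.2 ⟨s, Subtype.ext hs⟩
  · exact congrArg Subtype.val ((hr ⟨x', hE.prop.1⟩).symm.trans h0)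

end FPInj

/-! ### The implications -/

open FPInj in
theorem mainTheorem1 (R : Type u) [Ring R] :
    List.TFAE [
      -- (1) the right module `R_R` is FP-injective
      IsFPInjective Rᵐᵒᵖ R,
      -- (2) the left module `_R R` is an FP-cogenerator
      IsFPCogenerator R R,
      -- (3) there is an fp-flat FP-cogenerator among the left modules
      ∃ (K : Type u) (_ : AddCommGroup K) (_ : Module R K), IsFpFlat R K ∧ IsFPCogenerator R K,
      -- (4) there is an fp-flat cogenerator among the left modules
      ∃ (K : Type u) (_ : AddCommGroup K) (_ : Module R K), IsFpFlat R K ∧ IsCogenerator R K,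
      -- (5) for `α` between finitely presented left modules, `α*` epi implies `α` mono
      ∀ (M N : Type u) [AddCommGroup M] [Module R M] [AddCommGroup N] [Module R N],
        Module.FinitePresentation R M → Module.FinitePresentation R N →
        ∀ α : M →ₗ[R] N, Function.Surjective (dualMap α) → Function.Injective α,
      -- (6) every finitely presented left module is semireflexive
      ∀ (M : Type u) [AddCommGroup M] [Module R M],
        Module.FinitePresentation R M → IsSemireflexive R M,
      -- (7) every finitely presented left module embeds in an fp-flat module
      ∀ (M : Type u) [AddCommGroup M] [Module R M],
        Module.FinitePresentation R M → EmbedsInFpFlat R M,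
      -- (8) every left module embeds in an fp-flat module
      ∀ (M : Type u) [AddCommGroup M] [Module R M], EmbedsInFpFlat R M,
      -- (8') every injective left module embeds in an fp-flat module
      ∀ (M : Type u) [AddCommGroup M] [Module R M], Module.Injective R M → EmbedsInFpFlat R M,
      -- (9) every FP-injective left module is fp-flat
      ∀ (M : Type u) [AddCommGroup M] [Module R M], IsFPInjective R M → IsFpFlat R M,
      -- (10) every injective left module is fp-flat
      ∀ (M : Type u) [AddCommGroup M] [Module R M], Module.Injective R M → IsFpFlat R M,
      -- (11) every indecomposable injective left module is fp-flat
      ∀ (M : Type u) [AddCommGroup M] [Module R M],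
        IsIndecomposable R M → Module.Injective R M → IsFpFlat R M,
      -- (12) every flat right module is fp-injective
      ∀ (F : Type u) [AddCommGroup F] [Module Rᵐᵒᵖ F],
        IsFlatRight R F → IsFpInjective Rᵐᵒᵖ F] := by
  tfae_have 1 → 10 := fun h M _ _ hM => isFpFlat_of_isFPInjective h hM
  tfae_have 10 → 11 := fun h M _ _ hM => h M (isFPInjective_of_injective hM)
  tfae_have 11 → 12 := fun h M _ _ _ hM => h M hM
  tfae_have 12 → 6 := by
    refine fun h M _ _ hM => isSemireflexive_iff.2 fun x hx => ?_
    by_contra h0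
    obtain ⟨E, _, _, hE, hE', g, hg⟩ :=
      exists_map_ne_zero_of_indecomposable_injective (R := R) h0
    exact hg ((h E hE hE').map_eq_zero hM x hx g)
  tfae_have 6 → 1 := fun h => isFPInjective_of_isSemireflexive h
  tfae_have 6 → 2 := fun h => IsSemireflexive.isFPCogenerator h
  tfae_have 2 → 3 := fun h => ⟨R, _, _, isFpFlat_self, h⟩
  tfae_have 3 → 6 := fun ⟨_, _, _, hK, hK'⟩ _ _ _ hM => hK'.isSemireflexive hK hM
  tfae_have 11 → 4 := fun h => exists_isFpFlat_isCogenerator h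
  tfae_have 4 → 3 := fun ⟨K, _, _, hK, hK'⟩ => ⟨K, _, _, hK, hK'.isFPCogenerator⟩
  tfae_have 6 → 5 := fun h M _ _ _ _ _ hM _ α hα => (h M hM).injective_of_dualMap α hα
  tfae_have 5 → 6 := fun h _ _ _ hM => isSemireflexive_of_injective_of_dualMap h hM
  tfae_have 11 → 8 := by
    intro h M _ _
    obtain ⟨Q, _, _, hQ, i⟩ := exists_injective_embedding (R := R) M
    exact ⟨Q, _, _, h Q hQ, i⟩
  tfae_have 8 → 9 := fun h M _ _ _ => h M
  tfae_have 9 → 7 := by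
    intro h M _ _ _
    obtain ⟨Q, _, _, hQ, i, hi⟩ := exists_injective_embedding (R := R) M
    obtain ⟨F, _, _, hF, j, hj⟩ := h Q hQ
    exact ⟨F, _, _, hF, j ∘ₗ i, hj.comp hi⟩
  tfae_have 7 → 6 := fun h M _ _ hM => (h M hM).isSemireflexive hM
  tfae_have 1 → 13 := fun h F _ _ hF => hF.isFpInjective h
  tfae_have 13 → 6 := fun h M _ _ hM =>
    isSemireflexive_of_isFpInjective (h R isFlatRight_self) hM
  tfae_finish
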